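/- Let $s\ge 0$ be an integer, let $N_l,K_l\ge 0$ $(l\ge 1)$, $M_l=\sum_{k=1}^{l}(N_k+K_k)$, $S=\bigcup_{l=1}^{s}[-M_l-N_l,-M_l]$, $S^{+}=\bigcup_{l=1}^{s}[M_l,M_l+N_l]$, $R^s=[0,\infty)\setminus S^{+}$, $O=(-\infty,0)\setminus S$. Let $a:R^s\to\mathbb C$ be integrable and $A(e^{i\lambda})=\int_{R^s}a(t)e^{-it\lambda}\,dt$. A spectral density is an (a.e.) non-negative function in $L_1(\mathbb R)$. For functions $f,g$ let $L_2^s(f+g)$ be the closed linear subspace of $L_2(\mathbb R,(f+g)\,d\lambda)$ generated by $\{e^{it\lambda}:t\in O\}$, and for measurable $h$ put $$\Delta(h;f,g)=\frac1{2\pi}\int_{-\infty}^{\infty}|A(e^{i\lambda})-h(\lambda)|^2f(\lambda)\,d\lambda+\frac1{2\pi}\int_{-\infty}^{\infty}|h(\lambda)|^2g(\lambda)\,d\lambda\in[0,\infty].$$ For uncorrelated stationary processes $\xi,\eta$ with spectral densities $f,g$ this is the mean-square error of the linear estimate with spectral characteristic $h$ of $A\xi=\int_{R^s}a(t)\xi(-t)\,dt$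 from the observations $\xi(t)+\eta(t)$, $t\in O$. The spectral characteristic $h(f,g)$ of the optimal linear estimate is the element of $L_2^s(f+g)$ such that $$\frac1{2\pi}\int_{-\infty}^{\infty}\bigl[A(e^{i\lambda})f(\lambda)-h(f,g)(\lambda)(f(\lambda)+g(\lambda))\bigr]e^{-it\lambda}\,d\lambda=0\quad\text{for all }t\in O$$ (it exists and is unique up to $(f+g)\,d\lambda$-null sets). Let $D_f,D_g$ be non-empty sets of spectral densities, $D=D_f\times D_g$, $H_D=\bigcap_{(f,g)\in D}L_2^s(f+g)$. Let $(f_0,g_0)$ be a solution of the unconstrained problem $$\Delta_D(f,g)=-\Delta(h^0;f,g)+\delta((f,g)\mid D)\to\inf,\qquad h^0=h(f_0,g_0),$$ where $\delta(\cdot\mid D)$ is $0$ on $D$ and $+\infty$ off $D$ (and $\Delta_D=+\infty$ off $D$), $h^0$ being any representative of $h(f_0,g_0)$. If $h^0\in H_D$, then: 1. $f_0,g_0$ are least favorable in $D$: $(f_0,g_0)\in D$ and $\Delta(h(f_0,g_0);f_0,g_0)=\max_{(f,g)\in D}\Delta(h(f,g);f,g)$; 2. $h^0$ is minimax-robust: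 $h^0\in H_D$ and $\min_{h\in H_D}\sup_{(f,g)\in D}\Delta(h;f,g)=\max_{(f,g)\in D}\Delta(h^0;f,g)$, the minimum and the right-hand maximum being attained; 3. $h^0$ and $(f_0,g_0)$ form a saddle point: $\Delta(h^0;f,g)\le\Delta(h^0;f_0,g_0)\le\Delta(h;f_0,g_0)$ for all $h\in H_D$, $(f,g)\in D$. -/

import Mathlib

open MeasureTheory Set
open scoped ENNReal NNReal

noncomputable section

namespace SpectralFiltering

/-- `M_l = ∑_{k=1}^l (N_k + K_k)` (with the convention `N_0 = K_0 = 0`). -/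
def gapStart (N K : ℕ → ℝ≥0) (l : ℕ) : ℝ := ∑ k ∈ Finset.Icc 1 l, ((N k : ℝ) + K k)

/-- The set of missed observations `S = ⋃_{l=1}^s [-M_l - N_l, -M_l]`. -/
def gaps (s : ℕ) (N K : ℕ → ℝ≥0) : Set ℝ :=
  ⋃ l ∈ Finset.Icc 1 s, Icc (-gapStart N K l - N l) (-gapStart N K l)

/-- The mirrored set `S⁺ = ⋃_{l=1}^s [M_l, M_l + N_l]`. -/
def gapsPos (s : ℕ) (N K : ℕ → ℝ≥0) : Set ℝ :=
  ⋃ l ∈ Finset.Icc 1 s, Icc (gapStart N K l) (gapStart N K l + N l)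

/-- The observation times `ℝ⁻ \ S`. -/
def obsTimes (s : ℕ) (N K : ℕ → ℝ≥0) : Set ℝ := Iio 0 \ gaps s N K

/-- `R^s = [0, ∞) \ S⁺`, the domain of integration of the functional
`Aξ = ∫_{R^s} a(t) ξ(-t) dt`. -/
def funTimes (s : ℕ) (N K : ℕ → ℝ≥0) : Set ℝ := Ici 0 \ gapsPos s N K

/-- `A(e^{iλ}) = ∫_R a(t) e^{-itλ} dt`, the integral being over `R = R^s`. -/
def transferFn (R : Set ℝ) (a : ℝ → ℂ) (lam : ℝ) : ℂ :=
  ∫ t in R, a t * Complex.exp (-(Complex.I * t * lam))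

/-- Spectral densities: (a.e.) non-negative Lebesgue integrable functions on `ℝ`. -/
structure IsSpectralDensity (f : ℝ → ℝ) : Prop where
  integrable : Integrable f
  nonneg : ∀ᵐ x, 0 ≤ f x

/-- The measure with density `f + g`, so that `L_2(f + g)` is `Lp ℂ 2 (specMeasure f g)`. -/
def specMeasure (f g : ℝ → ℝ) : Measure ℝ :=
  volume.withDensity (fun x => ENNReal.ofReal (f x + g x))

/-- `L_2^s(f + g)`: the closed linear subspace of `L_2(f + g)` generated by the functions
`λ ↦ e^{itλ}`, `t` running over the set `O` of observation times. -/
def obsSubspace (O : Set ℝ) (f g : ℝ → ℝ) : Submodule ℂ (Lp ℂ 2 (specMeasure f g)) :=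
  (Submodule.span ℂ {u : Lp ℂ 2 (specMeasure f g) |
    ∃ t ∈ O, u =ᵐ[specMeasure f g] fun x : ℝ => Complex.exp (Complex.I * t * x)}).topologicalClosure

/-- The function `h` belongs to `L_2^s(f + g)`. -/
def MemL2s (O : Set ℝ) (f g : ℝ → ℝ) (h : ℝ → ℂ) : Prop :=
  ∃ hh : MemLp h 2 (specMeasure f g), hh.toLp h ∈ obsSubspace O f g

/-- The mean-square error of the linear estimate with spectral characteristic `h`,
`Δ(h; f, g) = (2π)⁻¹ ∫ |A - h|² f dλ + (2π)⁻¹ ∫ |h|² g dλ`, as an element of `[0, ∞]`. -/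
def mse (A : ℝ → ℂ) (h : ℝ → ℂ) (f g : ℝ → ℝ) : ℝ≥0∞ :=
  ENNReal.ofReal (1 / (2 * Real.pi)) * (∫⁻ x, ‖A x - h x‖ₑ ^ 2 * ENNReal.ofReal (f x)) +
  ENNReal.ofReal (1 / (2 * Real.pi)) * (∫⁻ x, ‖h x‖ₑ ^ 2 * ENNReal.ofReal (g x))

/-- `h` is (a representative of) the spectral characteristic `h(f, g)` of the optimal linear
estimate, i.e. of the orthogonal projection: `h ∈ L_2^s(f + g)`, and the error of the estimate is
orthogonal to all the observations. -/
structure IsOptimalChar (O : Set ℝ) (A : ℝ → ℂ) (f g : ℝ → ℝ) (h : ℝ → ℂ) : Prop where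
  mem : MemL2s O f g h
  orth : ∀ t ∈ O, ((1 / (2 * Real.pi) : ℝ) : ℂ) *
    ∫ x : ℝ, (A x * f x - h x * (f x + g x)) * Complex.exp (-(Complex.I * t * x)) = 0

lemma continuous_transferFn {R : Set ℝ} {a : ℝ → ℂ} (ha : IntegrableOn a R) :
    Continuous (transferFn R a) := by
  have hn : ∀ t x : ℝ, ‖Complex.exp (-(Complex.I * t * x))‖ = 1 := fun t x => by
    have : -(Complex.I * t * x) = ((-(t * x) : ℝ) : ℂ) * Complex.I := by push_cast; ring
    rw [this, Complex.norm_exp_ofReal_mul_I]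
  refine continuous_of_dominated (bound := fun t => ‖a t‖) ?_ ?_ ha.norm ?_
  · intro x
    exact ha.aestronglyMeasurable.mul (by fun_prop : Continuous fun t : ℝ =>
      Complex.exp (-(Complex.I * t * x))).aestronglyMeasurable
  · intro x
    filter_upwards with t
    rw [norm_mul, hn, mul_one]
  · filter_upwards with t
    fun_prop

lemma norm_transferFn_le {R : Set ℝ} {a : ℝ → ℂ} (x : ℝ) :
    ‖transferFn R a x‖ ≤ ∫ t in R, ‖a t‖ := by
  refine (norm_integral_le_integral_norm _).trans (le_of_eq ?_)
  congr 1
  ext t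
  have : -(Complex.I * t * x) = ((-(t * x) : ℝ) : ℂ) * Complex.I := by push_cast; ring
  rw [norm_mul, this, Complex.norm_exp_ofReal_mul_I, mul_one]

/-- The optimal spectral characteristic exists. -/
theorem exists_isOptimalChar (O : Set ℝ) {R : Set ℝ} {a : ℝ → ℂ} (ha : IntegrableOn a R)
    {f g : ℝ → ℝ} (hf : IsSpectralDensity f) (hg : IsSpectralDensity g) :
    ∃ h, IsOptimalChar O (transferFn R a) f g h := by
  set A := transferFn R a
  have hmeas : AEMeasurable (fun x => (f x + g x).toNNReal) volume :=
    (hf.integrable.add hg.integrable).aestronglyMeasurable.aemeasurable.real_toNNReal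
  have hac : specMeasure f g ≪ volume := withDensity_absolutelyContinuous _ _
  have hfin : IsFiniteMeasure (specMeasure f g) :=
    isFiniteMeasure_withDensity_ofReal (hf.integrable.add hg.integrable).2
  have hu : MemLp (fun x => A x * ((f x / (f x + g x) : ℝ) : ℂ)) 2 (specMeasure f g) := by
    refine MemLp.of_bound ?_ (∫ t in R, ‖a t‖) ?_
    · refine (continuous_transferFn ha).aestronglyMeasurable.mul ?_
      refine AEMeasurable.aestronglyMeasurable ?_
      refine Complex.measurable_ofReal.comp_aemeasurable ?_
      exact ((hf.integrable.aestronglyMeasurable.aemeasurable.div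
        (hf.integrable.add hg.integrable).aestronglyMeasurable.aemeasurable)).mono_ac hac
    · filter_upwards [hac hf.nonneg, hac hg.nonneg] with x h1 h2
      rw [norm_mul]
      refine (mul_le_of_le_one_right (norm_nonneg _) ?_).trans (norm_transferFn_le x)
      rw [Complex.norm_real, Real.norm_of_nonneg (by positivity)]
      exact div_le_one_of_le₀ (by linarith) (by positivity)
  have hcl : IsClosed (obsSubspace O f g : Set (Lp ℂ 2 (specMeasure f g))) :=
    Submodule.isClosed_topologicalClosure _
  have : CompleteSpace (obsSubspace O f g) := hcl.completeSpace_coe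
  set P := (obsSubspace O f g).orthogonalProjectionOnto (hu.toLp _)
  refine ⟨(P : Lp ℂ 2 (specMeasure f g)), ⟨Lp.memLp _, ?_⟩, ?_⟩
  · rw [Lp.toLp_coeFn]; exact P.2
  intro t ht
  have he : MemLp (fun x : ℝ => Complex.exp (Complex.I * t * x)) 2 (specMeasure f g) := by
    refine MemLp.of_bound (by fun_prop : Continuous fun x : ℝ =>
      Complex.exp (Complex.I * t * x)).aestronglyMeasurable 1 ?_
    filter_upwards with x
    have : Complex.I * t * x = ((t * x : ℝ) : ℂ) * Complex.I := by push_cast; ring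
    rw [this, Complex.norm_exp_ofReal_mul_I]
  have hmem : he.toLp _ ∈ obsSubspace O f g :=
    Submodule.le_topologicalClosure _ (Submodule.subset_span ⟨t, ht, he.coeFn_toLp⟩)
  have h0 : inner ℂ (he.toLp _) (hu.toLp _ - (P : Lp ℂ 2 (specMeasure f g))) = 0 :=
    (Submodule.sub_starProjection_mem_orthogonal (K := obsSubspace O f g) (hu.toLp _)) _ hmem
  rw [L2.inner_def] at h0
  have h1 : ∫ x, (A x * ((f x / (f x + g x) : ℝ) : ℂ) - (P : Lp ℂ 2 (specMeasure f g)) x)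
      * Complex.exp (-(Complex.I * t * x)) ∂(specMeasure f g) = 0 := by
    rw [← h0]
    refine integral_congr_ae ?_
    filter_upwards [he.coeFn_toLp, hu.coeFn_toLp,
      Lp.coeFn_sub (hu.toLp _) (P : Lp ℂ 2 (specMeasure f g))] with x e1 e2 e3
    rw [e3, e1, Pi.sub_apply, e2, RCLike.inner_apply, ← Complex.exp_conj]
    simp
  have h2 := integral_withDensity_eq_integral_smul₀ hmeas fun x : ℝ =>
    (A x * ((f x / (f x + g x) : ℝ) : ℂ) - (P : Lp ℂ 2 (specMeasure f g)) x)
      * Complex.exp (-(Complex.I * t * x))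
  refine mul_eq_zero_of_right _ (Eq.trans ?_ (h2.symm.trans h1))
  refine integral_congr_ae ?_
  filter_upwards [hf.nonneg, hg.nonneg] with x h1 h2
  rw [NNReal.smul_def, Real.coe_toNNReal _ (by positivity), Complex.real_smul]
  rcases eq_or_ne (f x + g x) 0 with h | h
  · have hf0 : f x = 0 := by linarith
    have hg0 : g x = 0 := by linarith
    simp [hf0, hg0]
  · have h' : (f x : ℂ) + g x ≠ 0 := by exact_mod_cast h
    push_cast
    field_simp

/-- The spectral characteristic `h(f, g)` of the optimal linear estimate. It exists for all spectral
densities by `exists_isOptimalChar`, and is unique up to a set of `specMeasure f g`-measure zero. -/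
def optimalChar (O : Set ℝ) (A : ℝ → ℂ) (f g : ℝ → ℝ) : ℝ → ℂ :=
  Classical.epsilon (IsOptimalChar O A f g)

/-- `Δ(f, g) = Δ(h(f, g); f, g)`, the mean-square error of the optimal linear estimate. -/
def optimalMse (O : Set ℝ) (A : ℝ → ℂ) (f g : ℝ → ℝ) : ℝ≥0∞ :=
  mse A (optimalChar O A f g) f g

/-- `f₀ ∈ D_f`, `g₀ ∈ D_g` are least favorable in `D_f × D_g`:
`Δ(f₀, g₀) = max_{(f, g) ∈ D_f × D_g} Δ(h(f, g); f, g)`. -/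
def IsLeastFavorable (O : Set ℝ) (A : ℝ → ℂ) (Df Dg : Set (ℝ → ℝ)) (f₀ g₀ : ℝ → ℝ) : Prop :=
  (f₀, g₀) ∈ Df ×ˢ Dg ∧
  IsGreatest ((fun p : (ℝ → ℝ) × (ℝ → ℝ) => optimalMse O A p.1 p.2) '' (Df ×ˢ Dg))
    (optimalMse O A f₀ g₀)

/-- `H_D = ⋂_{(f, g) ∈ D_f × D_g} L_2^s(f + g)`. -/
def admissibleChars (O : Set ℝ) (Df Dg : Set (ℝ → ℝ)) : Set (ℝ → ℂ) :=
  {h | ∀ f ∈ Df, ∀ g ∈ Dg, MemL2s O f g h}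

/-- `h₀` is minimax-robust: `h₀ ∈ H_D` and
`min_{h ∈ H_D} max_{(f, g) ∈ D} Δ(h; f, g) = max_{(f, g) ∈ D} Δ(h₀; f, g)`. The maximum for `h₀` is
attained; for the other `h ∈ H_D` the maximum is read as a supremum in `[0, ∞]`. -/
def IsMinimaxRobust (O : Set ℝ) (A : ℝ → ℂ) (Df Dg : Set (ℝ → ℝ)) (h₀ : ℝ → ℂ) : Prop :=
  h₀ ∈ admissibleChars O Df Dg ∧
  ∃ m : ℝ≥0∞,
    IsGreatest ((fun p : (ℝ → ℝ) × (ℝ → ℝ) => mse A h₀ p.1 p.2) '' (Df ×ˢ Dg)) m ∧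
    IsLeast ((fun h : ℝ → ℂ => ⨆ p ∈ Df ×ˢ Dg, mse A h p.1 p.2) '' admissibleChars O Df Dg) m

/-- `(h₀; f₀, g₀)` is a saddle point of `Δ(h; f, g)` on `H_D × D`. -/
def IsSaddle (O : Set ℝ) (A : ℝ → ℂ) (Df Dg : Set (ℝ → ℝ)) (h₀ : ℝ → ℂ) (f₀ g₀ : ℝ → ℝ) : Prop :=
  h₀ ∈ admissibleChars O Df Dg ∧ (f₀, g₀) ∈ Df ×ˢ Dg ∧
  ∀ h ∈ admissibleChars O Df Dg, ∀ f ∈ Df, ∀ g ∈ Dg,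
    mse A h₀ f g ≤ mse A h₀ f₀ g₀ ∧ mse A h₀ f₀ g₀ ≤ mse A h f₀ g₀

open Classical in
/-- The indicator function `δ(· | D)` of convex analysis: `0` on `D` and `+∞` off `D`. -/
def cvxIndicator {X : Type*} (D : Set X) (p : X) : EReal := if p ∈ D then 0 else ⊤

/-- The objective `Δ_D(f, g) = -Δ(h₀; f, g) + δ((f, g) | D_f × D_g)`, defined for all pairs of
functions. It is written as `-(Δ - δ)`, so that `+∞` prevails off `D` even where `Δ = +∞`
(in `EReal` one has `⊥ + ⊤ = ⊥`). -/
def objective (A : ℝ → ℂ) (Df Dg : Set (ℝ → ℝ)) (h₀ : ℝ → ℂ) (p : (ℝ → ℝ) × (ℝ → ℝ)) : EReal :=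
  -((mse A h₀ p.1 p.2 : EReal) - cvxIndicator (Df ×ˢ Dg) p)

end SpectralFiltering

end

namespace SpectralFiltering

/-! The heart is the saddle point: two independent optimality properties of `h₀` meet at `(f₀, g₀)`.
Solving the unconstrained problem means that `(f₀, g₀)` maximizes the error of the fixed filter `h₀`
over `D` (`mse_le_of_objective_minimizer`). Being optimal for `(f₀, g₀)`, `h₀` minimizes the error
there over all of `L_2^s(f₀ + g₀)`, which contains `H_D` (`IsOptimalChar.mse_le`). Robustness and
least favorability follow by chaining inequalities; for the latter, `h₀ ∈ H_D` makes `h₀` a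
competitor of `h(f, g)` at every `(f, g) ∈ D`.

The minimizing property is Hilbert space projection: by `mse_eq` the error is, up to a factor and a
term free of `h`, the squared distance from `h` to the Wiener filter, and the orthogonality
equations place their difference in the orthogonal complement of `L_2^s(f + g)`. -/

/-- The Wiener filter `A f / (f + g)`, whose projection onto `L_2^s(f + g)` is the optimal
spectral characteristic. -/
noncomputable def wienerFilter (A : ℝ → ℂ) (f g : ℝ → ℝ) (x : ℝ) : ℂ :=
  A x * ((f x / (f x + g x) : ℝ) : ℂ)

section SpecMeasure

variable {f g : ℝ → ℝ}

lemma aemeasurable_add_density (hf : IsSpectralDensity f) (hg : IsSpectralDensity g) :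
    AEMeasurable (fun x => f x + g x) volume :=
  (hf.integrable.add hg.integrable).aestronglyMeasurable.aemeasurable

lemma specMeasure_absolutelyContinuous : specMeasure f g ≪ volume :=
  withDensity_absolutelyContinuous _ _

lemma isFiniteMeasure_specMeasure (hf : IsSpectralDensity f) (hg : IsSpectralDensity g) :
    IsFiniteMeasure (specMeasure f g) :=
  isFiniteMeasure_withDensity_ofReal (hf.integrable.add hg.integrable).2

lemma ae_specMeasure_pos (hf : IsSpectralDensity f) (hg : IsSpectralDensity g) :
    ∀ᵐ x ∂(specMeasure f g), 0 < f x + g x := by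
  refine (ae_withDensity_iff' (aemeasurable_add_density hf hg).ennreal_ofReal).2 ?_
  filter_upwards with x hx
  exact ENNReal.ofReal_pos.1 (pos_iff_ne_zero.2 hx)

/-- Moves both halves of the error, `p = f` and `p = g`, onto the common measure `(f + g) dλ`. The
bound `p ≤ f + g` forces `p = 0` where the quotient is a division by zero. -/
lemma lintegral_mul_density (hf : IsSpectralDensity f) (hg : IsSpectralDensity g) {p : ℝ → ℝ}
    (hp : ∀ᵐ x, 0 ≤ p x ∧ p x ≤ f x + g x) (F : ℝ → ℝ≥0∞) :
    ∫⁻ x, F x * ENNReal.ofReal (p x) =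
      ∫⁻ x, F x * ENNReal.ofReal (p x / (f x + g x)) ∂(specMeasure f g) := by
  rw [specMeasure, lintegral_withDensity_eq_lintegral_mul_non_measurable₀ _
    (aemeasurable_add_density hf hg).ennreal_ofReal (by simp)]
  refine lintegral_congr_ae ?_
  filter_upwards [hp] with x ⟨h0, h1⟩
  rw [Pi.mul_apply, mul_left_comm, ← ENNReal.ofReal_mul (h0.trans h1)]
  rcases eq_or_ne (f x + g x) 0 with h | h
  · have : p x = 0 := le_antisymm (h1.trans_eq h) h0
    simp [this]
  · rw [mul_div_cancel₀ _ h]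

lemma memLp_wienerFilter {A : ℝ → ℂ} (hA : Continuous A) {C : ℝ} (hC : ∀ x, ‖A x‖ ≤ C)
    (hf : IsSpectralDensity f) (hg : IsSpectralDensity g) :
    MemLp (wienerFilter A f g) 2 (specMeasure f g) := by
  have := isFiniteMeasure_specMeasure hf hg
  refine MemLp.of_bound ?_ C ?_
  · refine hA.aestronglyMeasurable.mul (AEMeasurable.aestronglyMeasurable ?_)
    exact Complex.measurable_ofReal.comp_aemeasurable
      ((hf.integrable.aestronglyMeasurable.aemeasurable.div
        (aemeasurable_add_density hf hg)).mono_ac specMeasure_absolutelyContinuous)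
  · filter_upwards [specMeasure_absolutelyContinuous hf.nonneg,
      specMeasure_absolutelyContinuous hg.nonneg] with x h1 h2
    rw [wienerFilter, norm_mul]
    refine (mul_le_of_le_one_right (norm_nonneg _) ?_).trans (hC x)
    rw [Complex.norm_real, Real.norm_of_nonneg (by positivity)]
    exact div_le_one_of_le₀ (by linarith) (by positivity)

end SpecMeasure

/-- Bias-variance decomposition for a variable equal to `A` with weight `p` and to `0` with weight
`q`: its mean is `A p`, its variance `‖A‖² p q`. -/
lemma norm_sub_sq_mul_add_norm_sq_mul (A h : ℂ) {p q : ℝ} (hpq : p + q = 1) :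
    ‖A - h‖ ^ 2 * p + ‖h‖ ^ 2 * q = ‖A * p - h‖ ^ 2 + ‖A‖ ^ 2 * (p * q) := by
  obtain rfl : q = 1 - p := by linarith
  simp only [Complex.sq_norm, Complex.normSq_apply, Complex.sub_re, Complex.sub_im,
    Complex.mul_re, Complex.mul_im, Complex.ofReal_re, Complex.ofReal_im]
  ring

/-- Completing the square: up to a term that does not depend on `h`, the error is the squared
distance of `h` from the Wiener filter. -/
lemma mse_eq {A : ℝ → ℂ} (hA : Continuous A) {f g : ℝ → ℝ} (hf : IsSpectralDensity f)
    (hg : IsSpectralDensity g) {h : ℝ → ℂ} (hh : AEStronglyMeasurable h (specMeasure f g))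
    (hu : AEStronglyMeasurable (wienerFilter A f g) (specMeasure f g)) :
    mse A h f g = ENNReal.ofReal (1 / (2 * Real.pi)) *
      ((∫⁻ x, ‖wienerFilter A f g x - h x‖ₑ ^ 2 ∂(specMeasure f g)) +
        ∫⁻ x, ENNReal.ofReal (‖A x‖ ^ 2 * (f x / (f x + g x) * (g x / (f x + g x))))
          ∂(specMeasure f g)) := by
  have hfm : AEMeasurable f (specMeasure f g) :=
    hf.integrable.aestronglyMeasurable.aemeasurable.mono_ac specMeasure_absolutelyContinuous
  have hwm : AEMeasurable (fun x => f x + g x) (specMeasure f g) :=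
    (aemeasurable_add_density hf hg).mono_ac specMeasure_absolutelyContinuous
  rw [mse, ← mul_add, lintegral_mul_density hf hg, lintegral_mul_density hf hg,
    ← lintegral_add_left', ← lintegral_add_left']
  · congr 1
    refine lintegral_congr_ae ?_
    filter_upwards [ae_specMeasure_pos hf hg, specMeasure_absolutelyContinuous hf.nonneg,
      specMeasure_absolutelyContinuous hg.nonneg] with x hw h1 h2
    have e : ∀ z : ℂ, ‖z‖ₑ ^ 2 = ENNReal.ofReal (‖z‖ ^ 2) := fun z => by
      rw [← ofReal_norm, ENNReal.ofReal_pow (norm_nonneg _)]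
    have hpq : f x / (f x + g x) + g x / (f x + g x) = 1 := by
      rw [← add_div, div_self hw.ne']
    simp only [e]
    rw [← ENNReal.ofReal_mul (by positivity), ← ENNReal.ofReal_mul (by positivity),
      ← ENNReal.ofReal_add (by positivity) (by positivity),
      ← ENNReal.ofReal_add (by positivity) (by positivity),
      norm_sub_sq_mul_add_norm_sq_mul _ _ hpq, wienerFilter]
  · exact (hu.sub hh).enorm.pow_const 2
  · exact ((hA.aestronglyMeasurable.sub hh).enorm.pow_const 2).mul (hfm.div hwm).ennreal_ofReal
  · filter_upwards [hf.nonneg, hg.nonneg] with x h1 h2 using ⟨h2, by linarith⟩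
  · filter_upwards [hf.nonneg, hg.nonneg] with x h1 h2 using ⟨h1, by linarith⟩

lemma lintegral_enorm_sub_sq {μ : Measure ℝ} {u h : ℝ → ℂ} (hu : MemLp u 2 μ) (hh : MemLp h 2 μ) :
    ∫⁻ x, ‖u x - h x‖ₑ ^ 2 ∂μ = ‖hu.toLp u - hh.toLp h‖ₑ ^ 2 := by
  rw [← MemLp.toLp_sub, Lp.enorm_toLp,
    eLpNorm_eq_lintegral_rpow_enorm_toReal two_ne_zero ENNReal.ofNat_ne_top, ← ENNReal.rpow_natCast,
    ← ENNReal.rpow_mul]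
  simp

lemma norm_sub_le_of_mem_orthogonal {E : Type*} [NormedAddCommGroup E] [InnerProductSpace ℂ E]
    {V : Submodule ℂ E} {u v w : E} (hv : v ∈ V) (hw : w ∈ V) (h : u - v ∈ Vᗮ) :
    ‖u - v‖ ≤ ‖u - w‖ := by
  have h0 : inner ℂ (u - v) (v - w) = 0 :=
    Submodule.inner_left_of_mem_orthogonal (V.sub_mem hv hw) h
  have := norm_add_sq_eq_norm_sq_add_norm_sq_of_inner_eq_zero (𝕜 := ℂ) _ _ h0
  rw [sub_add_sub_cancel] at this
  nlinarith [norm_nonneg (u - v), norm_nonneg (u - w), mul_self_nonneg ‖v - w‖]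

/-- The error of the optimal estimate is orthogonal to the observations. -/
lemma IsOptimalChar.sub_mem_orthogonal {O : Set ℝ} {A : ℝ → ℂ} {f g : ℝ → ℝ}
    (hf : IsSpectralDensity f) (hg : IsSpectralDensity g) {h : ℝ → ℂ}
    (hopt : IsOptimalChar O A f g h) (hu : MemLp (wienerFilter A f g) 2 (specMeasure f g))
    (hh : MemLp h 2 (specMeasure f g)) :
    hu.toLp _ - hh.toLp h ∈ (obsSubspace O f g)ᗮ := by
  -- Closure does not change the orthogonal complement, so testing against the exponentials
  -- suffices.
  rw [obsSubspace, Submodule.orthogonal_closure, Submodule.mem_orthogonal]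
  intro v hv
  induction hv using Submodule.span_induction with
  | zero => exact inner_zero_left _
  | add v w _ _ h1 h2 => rw [inner_add_left, h1, h2, add_zero]
  | smul c v _ h1 => rw [inner_smul_left, h1, mul_zero]
  | mem v hv =>
    obtain ⟨t, ht, hvt⟩ := hv
    have h1 := (mul_eq_zero.1 (hopt.orth t ht)).resolve_left
      (Complex.ofReal_ne_zero.2 (by positivity))
    have h2 := integral_withDensity_eq_integral_smul₀
      (aemeasurable_add_density hf hg).real_toNNReal fun x : ℝ =>
      (wienerFilter A f g x - h x) * Complex.exp (-(Complex.I * t * x))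
    rw [L2.inner_def]
    refine Eq.trans ?_ (h2.trans (Eq.trans ?_ h1))
    · refine integral_congr_ae ?_
      filter_upwards [hvt, hu.coeFn_toLp, hh.coeFn_toLp,
        Lp.coeFn_sub (hu.toLp _) (hh.toLp h)] with x e1 e2 e3 e4
      rw [e4, e1, Pi.sub_apply, e2, e3, RCLike.inner_apply, ← Complex.exp_conj]
      simp
    · refine integral_congr_ae ?_
      filter_upwards [hf.nonneg, hg.nonneg] with x h1 h2
      rw [NNReal.smul_def, Real.coe_toNNReal _ (by positivity), Complex.real_smul, wienerFilter]
      -- Where `f + g = 0` both densities vanish, so the value of the quotient there is irrelevant.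
      rcases eq_or_ne (f x + g x) 0 with h | h
      · have hf0 : f x = 0 := by linarith
        have hg0 : g x = 0 := by linarith
        simp [hf0, hg0]
      · have h' : (f x : ℂ) + g x ≠ 0 := by exact_mod_cast h
        push_cast
        field_simp

/-- The optimal spectral characteristic minimizes the mean-square error over `L_2^s(f + g)`. -/
theorem IsOptimalChar.mse_le {O : Set ℝ} {A : ℝ → ℂ} (hA : Continuous A) {C : ℝ}
    (hC : ∀ x, ‖A x‖ ≤ C) {f g : ℝ → ℝ} (hf : IsSpectralDensity f) (hg : IsSpectralDensity g)
    {h k : ℝ → ℂ} (hopt : IsOptimalChar O A f g h) (hk : MemL2s O f g k) :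
    mse A h f g ≤ mse A k f g := by
  obtain ⟨hh, hhO⟩ := hopt.mem
  obtain ⟨hk, hkO⟩ := hk
  have hu := memLp_wienerFilter hA hC hf hg
  rw [mse_eq hA hf hg hh.1 hu.1, mse_eq hA hf hg hk.1 hu.1, lintegral_enorm_sub_sq hu hh,
    lintegral_enorm_sub_sq hu hk]
  gcongr
  rw [← ofReal_norm, ← ofReal_norm]
  exact ENNReal.ofReal_le_ofReal
    (norm_sub_le_of_mem_orthogonal hhO hkO (hopt.sub_mem_orthogonal hf hg hu hh))

section Objective

variable {A : ℝ → ℂ} {Df Dg : Set (ℝ → ℝ)} {h₀ : ℝ → ℂ} {p : (ℝ → ℝ) × (ℝ → ℝ)}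

lemma objective_of_mem (hp : p ∈ Df ×ˢ Dg) :
    objective A Df Dg h₀ p = -(mse A h₀ p.1 p.2 : EReal) := by
  rw [objective, cvxIndicator, if_pos hp, sub_zero]

lemma objective_of_notMem (hp : p ∉ Df ×ˢ Dg) : objective A Df Dg h₀ p = ⊤ := by
  rw [objective, cvxIndicator, if_neg hp, EReal.sub_top, EReal.neg_bot]

/-- On `D` the objective is minus a nonnegative quantity, hence never `⊤`, while off `D` it is
always `⊤`. -/
lemma mem_of_objective_minimizer (hne : (Df ×ˢ Dg).Nonempty)
    (hp : ∀ q, objective A Df Dg h₀ p ≤ objective A Df Dg h₀ q) : p ∈ Df ×ˢ Dg := by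
  by_contra hmem
  obtain ⟨q, hq⟩ := hne
  have := hp q
  rw [objective_of_notMem hmem, objective_of_mem hq, top_le_iff, EReal.neg_eq_top_iff] at this
  exact EReal.coe_ennreal_ne_bot _ this

lemma mse_le_of_objective_minimizer (hne : (Df ×ˢ Dg).Nonempty)
    (hp : ∀ q, objective A Df Dg h₀ p ≤ objective A Df Dg h₀ q) {q : (ℝ → ℝ) × (ℝ → ℝ)}
    (hq : q ∈ Df ×ˢ Dg) : mse A h₀ q.1 q.2 ≤ mse A h₀ p.1 p.2 := by
  have := hp q
  rwa [objective_of_mem (mem_of_objective_minimizer hne hp), objective_of_mem hq,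
    EReal.neg_le_neg_iff, EReal.coe_ennreal_le_coe_ennreal_iff] at this

end Objective

end SpectralFiltering

theorem mainTheorem7 (s : ℕ) (N K : ℕ → NNReal) (a : ℝ → ℂ)
    (ha : MeasureTheory.IntegrableOn a (SpectralFiltering.funTimes s N K))
    (Df Dg : Set (ℝ → ℝ)) (hDf_ne : Df.Nonempty) (hDg_ne : Dg.Nonempty)
    (hDf : ∀ f ∈ Df, SpectralFiltering.IsSpectralDensity f)
    (hDg : ∀ g ∈ Dg, SpectralFiltering.IsSpectralDensity g)
    (A : ℝ → ℂ) (hA : A = SpectralFiltering.transferFn (SpectralFiltering.funTimes s N K) a)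
    (O : Set ℝ) (hO : O = SpectralFiltering.obsTimes s N K)
    (f₀ g₀ : ℝ → ℝ) (h₀ : ℝ → ℂ) (hh₀ : SpectralFiltering.IsOptimalChar O A f₀ g₀ h₀)
    (hsol : ∀ p : (ℝ → ℝ) × (ℝ → ℝ),
      SpectralFiltering.objective A Df Dg h₀ (f₀, g₀) ≤ SpectralFiltering.objective A Df Dg h₀ p)
    (hHD : h₀ ∈ SpectralFiltering.admissibleChars O Df Dg) :
    SpectralFiltering.IsLeastFavorable O A Df Dg f₀ g₀ ∧
    SpectralFiltering.IsMinimaxRobust O A Df Dg h₀ ∧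
    SpectralFiltering.IsSaddle O A Df Dg h₀ f₀ g₀ := by
  subst hA
  have hcont := SpectralFiltering.continuous_transferFn ha
  have hbound := SpectralFiltering.norm_transferFn_le (R := SpectralFiltering.funTimes s N K)
    (a := a)
  have hne : (Df ×ˢ Dg).Nonempty := hDf_ne.prod hDg_ne
  have h₀mem := SpectralFiltering.mem_of_objective_minimizer hne hsol
  have hmax := fun (p : (ℝ → ℝ) × (ℝ → ℝ)) (hp : p ∈ Df ×ˢ Dg) =>
    SpectralFiltering.mse_le_of_objective_minimizer hne hsol hp
  have hf₀ := hDf _ h₀mem.1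
  have hg₀ := hDg _ h₀mem.2
  have hmin : ∀ h, SpectralFiltering.MemL2s O f₀ g₀ h → _ := fun h hh =>
    hh₀.mse_le hcont hbound hf₀ hg₀ hh
  -- Existence of an optimal characteristic is what gives the `epsilon` choice its meaning.
  have hopt : ∀ f ∈ Df, ∀ g ∈ Dg, SpectralFiltering.IsOptimalChar O
      (SpectralFiltering.transferFn (SpectralFiltering.funTimes s N K) a) f g
      (SpectralFiltering.optimalChar O _ f g) := fun f hf g hg =>
    Classical.epsilon_spec (SpectralFiltering.exists_isOptimalChar O ha (hDf f hf) (hDg g hg))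
  refine ⟨⟨h₀mem, ⟨_, h₀mem, rfl⟩, ?_⟩, ⟨hHD, _, ⟨⟨_, h₀mem, rfl⟩, ?_⟩, ⟨h₀, hHD, ?_⟩, ?_⟩,
    hHD, h₀mem, fun h hh f hf g hg => ⟨hmax (f, g) ⟨hf, hg⟩, hmin h (hh f₀ h₀mem.1 g₀ h₀mem.2)⟩⟩
  · rintro _ ⟨⟨f, g⟩, ⟨hf, hg⟩, rfl⟩
    -- In turn: optimality of `h(f, g)` against `h₀`, maximality of `(f₀, g₀)` for `h₀`, and
    -- optimality of `h₀`. The last link is needed because `h₀` and `optimalChar` at `(f₀, g₀)` may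
    -- be different representatives.
    calc
      _ ≤ _ := (hopt f hf g hg).mse_le hcont hbound (hDf f hf) (hDg g hg) (hHD f hf g hg)
      _ ≤ _ := hmax (f, g) ⟨hf, hg⟩
      _ ≤ _ := hmin _ (hopt f₀ h₀mem.1 g₀ h₀mem.2).mem
  · rintro _ ⟨p, hp, rfl⟩
    exact hmax p hp
  -- The minimax value is the error of `h₀` at `(f₀, g₀)`, where its supremum over `D` is attained.
  · exact le_antisymm (iSup₂_le hmax) (le_iSup₂_of_le (f₀, g₀) h₀mem le_rfl)
  · rintro _ ⟨h, hh, rfl⟩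
    exact (hmin h (hh f₀ h₀mem.1 g₀ h₀mem.2)).trans (le_iSup₂_of_le (f₀, g₀) h₀mem le_rfl)
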